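/- Let $n\ge 2$ be a natural number; indices $i,j,k,m,l,\dots$ range over $n=\{0,\dots,n-1\}$ unless said otherwise. We consider algebras $\mathfrak A=\langle A,+,\cdot,-,0,1,c_i,d_{ij}\rangle_{i,j<n}$ with $0\ne 1$, unary $c_i$ and constants $d_{ij}$. Put $s^i_ix=x$ and $s^i_jx=c_i(x\cdot d_{ij})$ for $i\neq j$. Let $[i/j]$ be the map on $n$ that sends $i$ to $j$ and fixes everything else, and $[i,j]$ the map that interchanges $i$ and $j$. $\mathrm{RC}_n$ is the class of those algebras for which $\langle A,+,\cdot,-,0,1\rangle$ is a Boolean algebra and, for all $x,y\in A$ and all $i,j,k$: (1) $c_i0=0$; (2) $x\le c_ix$; (3) $c_i(x\cdot c_iy)=c_ix\cdot c_iy$; (4) $d_{ii}=1$; (5) $d_{ij}=d_{ji}$, and $d_{ik}\cdot d_{kj}\le d_{ij}$ and $d_{ji}=c_kd_{ji}$ whenever $k\ne i,j$; (6) $c_i(x\cdot d_{ij})\cdot d_{ij}\le x$ whenever $i\neq j$; (7) $s^{i_m}_{j_m}c_{k_m}\cdots s^{i_1}_{j_1}c_{k_1}x\cdot\prod_{l\in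 K}d_{l\tau(l)}\le c_ix$ for all $m\ge1$ and all $i_1,\dots,i_m,j_1,\dots,j_m,k_1,\dots,k_m,i<n$ such that $k_{t+1}\notin([i_t/j_t]\circ\cdots\circ[i_1/j_1])(K)$ for all $0\le t<m$, where $\tau=[i_m/j_m]\circ\cdots\circ[i_1/j_1]$ and $K=\{i_1,\dots,i_m,k_1,\dots,k_m\}\setminus\{i\}$. $\mathrm{DC}_n$ is the class of those $\mathfrak A\in\mathrm{RC}_n$ that also satisfy (8) $c_jc_ix\cdot d_{jk}\le c_ic_jx$ for $k\ne i,j$; (9) $d_{ij}=c_k(d_{ik}\cdot d_{kj})$ for $k\neq i,j$; (10) $s^k_is^i_js^j_ms^m_kc_kx=s^k_ms^m_is^i_js^j_kc_kx$ for $k\ne i,j,m$ and $m\neq i,j$. $\mathrm{SC}_n$ is the class of those $\mathfrak A\in\mathrm{DC}_n$ that also satisfy, if $n=2$, (11) $x\cdot -d_{01}\le c_0c_1(-d_{01}\cdot s^0_1c_1x\cdot s^1_0c_0x)$, and, if $n\ge3$, (12) $x\le c_ic_j\bigl(s^i_jc_jx\cdot s^j_ic_ix\cdot\prod_{k\ne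 i,j}s^k_is^i_js^j_kc_kx\bigr)$ for all $i,j$. For a non-empty set $V$ of sequences of length $n$ let $\mathfrak P(V)$ be the algebra of all subsets of $V$ with the set-theoretic Boolean operations, $C_iX=\{f\in V:\text{some } g\in X \text{ agrees with } f \text{ outside } i\}$ and $D_{ij}=\{f\in V: f(i)=f(j)\}$. $\mathrm{RCs}_n$ is the class of all subalgebras of algebras $\mathfrak P(V)$; $\mathrm{DCs}_n$ is the class of those for which $f\circ[i/j]\in V$ for all $f\in V$ and all $i,j$; $\mathrm{SCs}_n$ is the class of those for which moreover $f\circ[i,j]\in V$ for all $f\in V$ and all $i,j$. **Theorem.** Let $n\ge2$, $\mathrm K\in\{\mathrm{RC},\mathrm{DC},\mathrm{SC}\}$ and $\mathfrak A\in\mathrm K_n$. (a) There are $\mathfrak B\in\mathrm{Ks}_n$ and an embedding of $\mathfrak A$ into $\mathfrak B$ that preserves all infinite sums and products existing in $\mathfrak A$, i.e. carries each of them to the corresponding sum or product in $\mathfrak B$. (b) If $\mathfrak A$ is atomic (in particular, if it is complete and atomic), then there are a full algebra $\mathfrak P(V)\in\mathrm{Ks}_n$ and an embedding $\Psi:\mathfrak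 A\to\mathfrak P(V)$ that is a complete representation: $\Psi(\sum S)=\bigcup_{x\in S}\Psi(x)$ for each $S\subseteq A$ whose sum exists in $\mathfrak A$, and $\Psi(\prod S)=\bigcap_{x\in S}\Psi(x)$ for each $S\subseteq A$ whose product exists in $\mathfrak A$ (with the empty intersection read as $V$). -/

import Mathlib

universe u v

/-- The non-Boolean operations of an algebra of the similarity type of cylindric algebras of
dimension `n` whose Boolean part is carried by `A`: cylindrifications `c i` and diagonal
elements `d i j`. -/
structure CylOps (n : ℕ) (A : Type u) where
  c : Fin n → A → A
  d : Fin n → Fin n → A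

/-- The transformation `[i/j]` of the index set: it sends `i` to `j` and fixes all else. -/
def repl {n : ℕ} (i j : Fin n) : Fin n → Fin n := Function.update id i j

namespace CylOps

variable {n : ℕ} {A : Type u} [BooleanAlgebra A] (O : CylOps n A)

/-- The substitution `s^i_j`: the identity if `i = j`, and `x ↦ c_i (x · d_ij)` otherwise. -/
def s (i j : Fin n) (x : A) : A := if i = j then x else O.c i (x ⊓ O.d i j)

/-- `s^{I (m-1)}_{J (m-1)} c_{K (m-1)} ⋯ s^{I 0}_{J 0} c_{K 0} x`. -/
def subIter (I J K : ℕ → Fin n) : ℕ → A → A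
  | 0, x => x
  | t + 1, x => O.s (I t) (J t) (O.c (K t) (subIter I J K t x))

end CylOps

/-- `[I (m-1)/J (m-1)] ∘ ⋯ ∘ [I 0/J 0]`, the identity for `m = 0`. -/
def replIter {n : ℕ} (I J : ℕ → Fin n) : ℕ → Fin n → Fin n
  | 0 => id
  | t + 1 => repl (I t) (J t) ∘ replIter I J t

/-- `{I 0, …, I (m-1), K 0, …, K (m-1)} \ {i}`. -/
def indexSet {n : ℕ} (I K : ℕ → Fin n) (m : ℕ) (i : Fin n) : Finset (Fin n) :=
  ((Finset.range m).image I ∪ (Finset.range m).image K).erase i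

namespace CylOps

variable {n : ℕ} {A : Type u} [BooleanAlgebra A] (O : CylOps n A)

/-- The axioms of `RC_n`. The Boolean axioms are the instance `BooleanAlgebra A`. -/
structure IsRC : Prop where
  ax1 : ∀ i, O.c i ⊥ = ⊥
  ax2 : ∀ i x, x ≤ O.c i x
  ax3 : ∀ i x y, O.c i (x ⊓ O.c i y) = O.c i x ⊓ O.c i y
  ax4 : ∀ i, O.d i i = ⊤
  /- The symmetry is required of all `i, j`; for `3 ≤ n` some `k ≠ i, j` exists anyway. -/
  ax5_symm : ∀ i j, O.d i j = O.d j i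
  ax5_trans : ∀ i j k, k ≠ i → k ≠ j → O.d i k ⊓ O.d k j ≤ O.d i j
  ax5_cyl : ∀ i j k, k ≠ i → k ≠ j → O.d j i = O.c k (O.d j i)
  ax6 : ∀ i j x, i ≠ j → O.c i (x ⊓ O.d i j) ⊓ O.d i j ≤ x
  ax7 : ∀ (m : ℕ) (I J K : ℕ → Fin n) (i : Fin n) (x : A), 1 ≤ m →
    (∀ t < m, K t ∉ (indexSet I K m i).image (replIter I J t)) →
    O.subIter I J K m x ⊓ (indexSet I K m i).inf (fun l => O.d l (replIter I J m l)) ≤ O.c i x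

/-- The axioms of `DC_n`. -/
structure IsDC : Prop extends O.IsRC where
  ax8 : ∀ i j k x, k ≠ i → k ≠ j → O.c j (O.c i x) ⊓ O.d j k ≤ O.c i (O.c j x)
  ax9 : ∀ i j k, k ≠ i → k ≠ j → O.d i j = O.c k (O.d i k ⊓ O.d k j)
  ax10 : ∀ i j k m x, k ≠ i → k ≠ j → k ≠ m → m ≠ i → m ≠ j →
    O.s k i (O.s i j (O.s j m (O.s m k (O.c k x)))) =
      O.s k m (O.s m i (O.s i j (O.s j k (O.c k x))))

/-- The axioms of `SC_n`: one further axiom for `n = 2`, another one for `n ≥ 3`. -/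
structure IsSC : Prop extends O.IsDC where
  ax11 : n = 2 → ∀ i j : Fin n, (i : ℕ) = 0 → (j : ℕ) = 1 → ∀ x,
    x ⊓ (O.d i j)ᶜ ≤ O.c i (O.c j ((O.d i j)ᶜ ⊓ O.s i j (O.c j x) ⊓ O.s j i (O.c i x)))
  ax12 : 3 ≤ n → ∀ i j x,
    x ≤ O.c i (O.c j (O.s i j (O.c j x) ⊓ O.s j i (O.c i x) ⊓
      (Finset.univ.filter (fun k : Fin n => k ≠ i ∧ k ≠ j)).inf
        (fun k => O.s k i (O.s i j (O.s j k (O.c k x))))))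

end CylOps

/-- The three kinds of algebras. -/
inductive CylKind where
  | RC
  | DC
  | SC

/-- Membership in `K_n`, for `K ∈ {RC, DC, SC}`. -/
def CylOps.InK {n : ℕ} {A : Type u} [BooleanAlgebra A] (O : CylOps n A) : CylKind → Prop
  | .RC => O.IsRC
  | .DC => O.IsDC
  | .SC => O.IsSC

/-- `V` is closed under `f ↦ f ∘ [i/j]`. -/
def Diagonalizable {n : ℕ} {U : Type v} (V : Set (Fin n → U)) : Prop :=
  ∀ f ∈ V, ∀ i j : Fin n, f ∘ repl i j ∈ V

/-- `V` is closed under `f ↦ f ∘ [i,j]`, where `[i,j]` interchanges `i` and `j`. -/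
def Permutable {n : ℕ} {U : Type v} (V : Set (Fin n → U)) : Prop :=
  ∀ f ∈ V, ∀ i j : Fin n, f ∘ Equiv.swap i j ∈ V

/-- The closure condition on the units of the set algebras of kind `K`. -/
def IsUnitOfKind {n : ℕ} {U : Type v} (V : Set (Fin n → U)) : CylKind → Prop
  | .RC => True
  | .DC => Diagonalizable V
  | .SC => Diagonalizable V ∧ Permutable V

/-- The operations `C_i^{[V]}` and `D_ij^{[V]}` of the full algebra `P(V)`, whose Boolean part
is the power set `Set V`. Here `f ≡_i g` iff `g = f(i/u)` for some `u`. -/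
def fullOps {n : ℕ} {U : Type v} (V : Set (Fin n → U)) : CylOps n (Set V) where
  c i X := {f | ∃ g ∈ X, ∃ w : U, (g : Fin n → U) = Function.update (f : Fin n → U) i w}
  d i j := {f | (f : Fin n → U) i = (f : Fin n → U) j}

/-- A member of `Ks_n`: a subalgebra of `P(V)` for a non-empty set `V` of sequences of length `n`
that satisfies the closure condition of kind `K`. -/
structure SetAlgebra (K : CylKind) (n : ℕ) where
  base : Type v
  unit : Set (Fin n → base)
  unit_nonempty : unit.Nonempty
  isUnitOfKind : IsUnitOfKind unit K
  carrier : BooleanSubalgebra (Set unit)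
  c_mem : ∀ i, ∀ X ∈ carrier, (fullOps unit).c i X ∈ carrier
  d_mem : ∀ i j, (fullOps unit).d i j ∈ carrier

/-- The operations of a member of `Ks_n`, restricted from `P(V)`. -/
def SetAlgebra.ops {K : CylKind} {n : ℕ} (B : SetAlgebra.{v} K n) : CylOps n B.carrier where
  c i X := ⟨(fullOps B.unit).c i X, B.c_mem i X X.2⟩
  d i j := ⟨(fullOps B.unit).d i j, B.d_mem i j⟩

/-- The Boolean homomorphism `f` is an embedding for all operations. (A bounded lattice
homomorphism between Boolean algebras preserves complements.) -/
structure IsCylEmbedding {n : ℕ} {A : Type u} {B : Type v} [BooleanAlgebra A] [BooleanAlgebra B]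
    (O : CylOps n A) (P : CylOps n B) (f : BoundedLatticeHom A B) : Prop where
  injective : Function.Injective f
  map_c : ∀ i x, f (O.c i x) = P.c i (f x)
  map_d : ∀ i j, f (O.d i j) = P.d i j

/-! The points are prime filters of the algebra: all of them for (a), those generated by atoms for
(b). The axioms make them a frame, with an equivalence relation `T i` for each cylindrification and
a predicate `E i j` for each diagonal. It is enough to label a set of sequences by points so that
agreement off `i` matches `T i` and equal coordinates match `E`; an element is then sent to the
sequences whose label contains it.

For RC the frame is unravelled into a tree of paths. A step changes one coordinate, copying an old
value if the diagonals demand it and using a fresh one otherwise. When two nodes agree off `i`, both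
branches can be peeled back to a common node while the positions of the shared values are tracked
(`linked_of_seq_eq`). Axiom (7) says that such a detour ends in the same `T i`-class
(`T_of_linked`), so the unravelling is a representation (`exists_rep_of_linked`).

For DC, axiom (9) provides substituted points, which forces closure under [i/j]. For SC, axioms (11)
and (12) give every point a partner under each transposition, correct up to any one coordinate of
the RC representation. The frame is then unravelled again with permutations built into the steps,
and the first representation shows that links still entail `T i` (`exists_permutable`).

In (a) the algebra is isomorphic to its image, so sums and products are kept; in (b) an atom below a
sum is below a summand. -/

/-- A relational structure of the type of the atom structures of cylindric-type algebras. -/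
structure CylFrame (n : ℕ) (W : Type u) where
  T : Fin n → W → W → Prop
  E : Fin n → Fin n → W → Prop
  T_refl : ∀ i w, T i w w
  T_symm : ∀ {i w w'}, T i w w' → T i w' w
  T_trans : ∀ {i w w' w''}, T i w w' → T i w' w'' → T i w w''
  E_refl : ∀ i w, E i i w
  E_symm : ∀ {i j w}, E i j w → E j i w
  E_trans : ∀ {i j k w}, E i j w → E j k w → E i k w
  E_of_T : ∀ {i j k w w'}, k ≠ i → k ≠ j → T k w w' → E i j w → E i j w'
  eq_of_T : ∀ {i j w v}, i ≠ j → E i j w → E i j v → T i w v → w = v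

/-- A representation of a frame: a labelling of a set of sequences by the points of the frame
under which the relations of the frame become the set-theoretic ones. -/
structure FrameRep {n : ℕ} {W : Type u} (F : CylFrame n W) where
  U : Type u
  V : Set (Fin n → U)
  label : (Fin n → U) → W
  diag_iff : ∀ f ∈ V, ∀ l m, f l = f m ↔ F.E l m (label f)
  T_of_agree : ∀ f ∈ V, ∀ g ∈ V, ∀ i, (∀ l, l ≠ i → f l = g l) → F.T i (label f) (label g)
  exists_agree : ∀ f ∈ V, ∀ i w, F.T i (label f) w →
    ∃ g ∈ V, label g = w ∧ ∀ l, l ≠ i → g l = f l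
  exists_label : ∀ w, ∃ f ∈ V, label f = w

namespace CylFrame

variable {n : ℕ} {W : Type u} (F : CylFrame n W) (G : Subgroup (Equiv.Perm (Fin n)))
  (sw : Equiv.Perm (Fin n) → W → W)

/-- Elementary moves of a point together with positions of all coordinates other than `i`. -/
inductive Move (i : Fin n) : W × (Fin n → Fin n) → W × (Fin n → Fin n) → Prop
  | slide (k : Fin n) (w w' : W) (τ : Fin n → Fin n) (hT : F.T k w w')
      (hk : ∀ l, l ≠ i → τ l ≠ k) : Move i (w, τ) (w', τ)
  | relabel (w : W) (τ τ' : Fin n → Fin n) (hE : ∀ l, l ≠ i → F.E (τ l) (τ' l) w) :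
      Move i (w, τ) (w, τ')
  | perm (π : Equiv.Perm (Fin n)) (hπ : π ∈ G) (w : W) (τ : Fin n → Fin n) :
      Move i (w, π ∘ τ) (sw π w, τ)
  | permSymm (π : Equiv.Perm (Fin n)) (hπ : π ∈ G) (w : W) (τ : Fin n → Fin n) :
      Move i (sw π w, τ) (w, π ∘ τ)

/-- Two states are linked if a sequence of moves leads from one to the other. -/
def Linked (i : Fin n) : W × (Fin n → Fin n) → W × (Fin n → Fin n) → Prop :=
  Relation.ReflTransGen (F.Move G sw i)

variable {F G sw}

theorem Move.symm {i : Fin n} {s t : W × (Fin n → Fin n)} (h : F.Move G sw i s t) :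
    F.Move G sw i t s := by
  cases h with
  | slide k w w' τ hT hk => exact .slide k w' w τ (F.T_symm hT) hk
  | relabel w τ τ' hE => exact .relabel w τ' τ fun l hl => F.E_symm (hE l hl)
  | perm π hπ w τ => exact .permSymm π hπ w τ
  | permSymm π hπ w τ => exact .perm π hπ w τ

theorem Linked.symm {i : Fin n} {s t : W × (Fin n → Fin n)} (h : F.Linked G sw i s t) :
    F.Linked G sw i t s := by
  induction h with
  | refl => exact .refl
  | tail _ h ih => exact .head h.symm ih

/-- A property of states that is preserved by moves is preserved by links. -/
theorem Linked.induct {i : Fin n} {s t : W × (Fin n → Fin n)} (h : F.Linked G sw i s t)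
    {p : W × (Fin n → Fin n) → Prop} (hp : ∀ s t, F.Move G sw i s t → p s → p t) (hs : p s) :
    p t := by
  induction h with
  | refl => exact hs
  | tail _ h ih => exact hp _ _ h ih

end CylFrame

/-! ### The unravelling tree and its sequences. -/

/-- The nodes of the unravelling of a frame. -/
inductive CylNode (n : ℕ) (W : Type u) : Type u
  | root (w : W) : CylNode n W
  | step (p : CylNode n W) (π : Equiv.Perm (Fin n)) (k : Fin n) (w : W) : CylNode n W

namespace CylNode

variable {n : ℕ} {W : Type u}

def label : CylNode n W → W
  | root w => w
  | step _ _ _ w => w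

def depth : CylNode n W → ℕ
  | root _ => 0
  | step p _ _ _ => p.depth + 1

/-- `r.IsPrefix p` says that `r` lies on the branch from the root to `p`. -/
def IsPrefix (r : CylNode n W) : CylNode n W → Prop
  | root w => r = root w
  | step p π k w => r = step p π k w ∨ IsPrefix r p

theorem IsPrefix.refl (p : CylNode n W) : p.IsPrefix p := by
  cases p with
  | root w => exact rfl
  | step p π k w => exact Or.inl rfl

theorem IsPrefix.eq_or_depth_lt {r p : CylNode n W} (h : r.IsPrefix p) :
    r = p ∨ r.depth < p.depth := by
  induction p with
  | root w => exact Or.inl h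
  | step p π k w ih =>
    rcases h with h | h
    · exact Or.inl h
    · right
      rcases ih h with rfl | h
      · exact Nat.lt_succ_self _
      · exact Nat.lt_succ_of_lt h

theorem IsPrefix.antisymm {r p : CylNode n W} (h : r.IsPrefix p) (h' : p.IsPrefix r) : r = p := by
  rcases h.eq_or_depth_lt with h | h
  · exact h
  · rcases h'.eq_or_depth_lt with h' | h'
    · exact h'.symm
    · omega

theorem not_isPrefix_step (p : CylNode n W) (π : Equiv.Perm (Fin n)) (k : Fin n) (w : W) :
    ¬ (step p π k w).IsPrefix p := by
  intro h
  have h := h.eq_or_depth_lt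
  rcases h with h | h
  · have := congrArg depth h
    simp [depth] at this
  · simp [depth] at h

variable (F : CylFrame n W) (G : Subgroup (Equiv.Perm (Fin n)))
  (sw : Equiv.Perm (Fin n) → W → W)

/-- The nodes that are paths in the frame. -/
def Valid : CylNode n W → Prop
  | root _ => True
  | step p π k w => Valid p ∧ π ∈ G ∧ F.T k (sw π p.label) w

/-- A coordinate chosen uniformly in the class of `l` under `E · · w`. -/
noncomputable def rep (w : W) (l : Fin n) : Fin n :=
  @Quotient.out _ (Setoid.mk (fun a b => F.E a b w)
    ⟨fun a => F.E_refl a w, F.E_symm, F.E_trans⟩) (Quotient.mk _ l)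

theorem rep_eq_iff (w : W) (l m : Fin n) : rep F w l = rep F w m ↔ F.E l m w := by
  unfold rep
  rw [Quotient.out_inj]
  exact Quotient.eq (r := Setoid.mk (fun a b => F.E a b w)
    ⟨fun a => F.E_refl a w, F.E_symm, F.E_trans⟩)

open Classical in
/-- The sequence attached to a node: a step changes the coordinate `k` to the value which the
diagonal elements prescribe, or to a new value if they prescribe none. -/
noncomputable def seq : CylNode n W → Fin n → CylNode n W × Fin n
  | root w, l => (root w, rep F w l)
  | step p π k w, l =>
    if l = k then
      if h : ∃ j, j ≠ k ∧ F.E k j w then seq p (π h.choose) else (step p π k w, k)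
    else seq p (π l)

variable {F G sw}

theorem seq_step_of_ne (p : CylNode n W) (π : Equiv.Perm (Fin n)) {k l : Fin n} (w : W)
    (h : l ≠ k) : seq F (step p π k w) l = seq F p (π l) := by
  simp [seq, h]

theorem seq_step_self (p : CylNode n W) (π : Equiv.Perm (Fin n)) {k : Fin n} {w : W}
    (h : ∃ j, j ≠ k ∧ F.E k j w) :
    ∃ j, j ≠ k ∧ F.E k j w ∧ seq F (step p π k w) k = seq F p (π j) := by
  refine ⟨h.choose, h.choose_spec.1, h.choose_spec.2, ?_⟩
  simp [seq, h]

theorem seq_step_new (p : CylNode n W) (π : Equiv.Perm (Fin n)) {k : Fin n} {w : W}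
    (h : ¬ ∃ j, j ≠ k ∧ F.E k j w) : seq F (step p π k w) k = (step p π k w, k) := by
  simp only [seq, if_true, dif_neg h]

/-- Every value carries the node that created it, so a value created by a step never occurs in the
predecessor of that step. -/
theorem isPrefix_seq (p : CylNode n W) (l : Fin n) : (seq F p l).1.IsPrefix p := by
  induction p generalizing l with
  | root w => exact IsPrefix.refl _
  | step p π k w ih =>
    by_cases hl : l = k
    · subst hl
      by_cases h : ∃ j, j ≠ l ∧ F.E l j w
      · obtain ⟨j, -, -, hj⟩ := seq_step_self p π h
        rw [hj]
        exact Or.inr (ih _)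
      · rw [seq_step_new p π h]
        exact Or.inl rfl
    · rw [seq_step_of_ne p π w hl]
      exact Or.inr (ih _)

/-- An injective sequence determines its node. -/
theorem isPrefix_of_injective (hn : 2 ≤ n) {p q : CylNode n W} {π ρ : Equiv.Perm (Fin n)}
    (h : seq F p ∘ π = seq F q ∘ ρ)
    (hinj : ∀ l m, F.E l m p.label → l = m) : p.IsPrefix q := by
  by_contra hpq
  -- The last step towards an injective sequence copies nothing, so it creates a value tagged by
  -- `p`; at a root every value is so tagged.
  have key : ∃ l, (seq F p l).1 = p := by
    cases p with
    | root w => exact ⟨⟨0, by omega⟩, rfl⟩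
    | step p π k w =>
      refine ⟨k, ?_⟩
      rw [seq_step_new p π]
      rintro ⟨j, hj, hjE⟩
      exact hj (hinj _ _ hjE).symm
  obtain ⟨l, hl⟩ := key
  have := congrFun h (π.symm l)
  simp only [Function.comp_apply, Equiv.apply_symm_apply] at this
  refine hpq ?_
  have h' := isPrefix_seq (F := F) q (ρ (π.symm l))
  rwa [← this, hl] at h'

/-- A step leaves the equalities off `k` alone, as `E_of_T` does for `E`; coordinate `k` is copied
when `E` prescribes a partner, and is fresh, hence different from all others, when it does not. -/
theorem seq_eq_iff
    (hE : ∀ π ∈ G, ∀ w l m, F.E l m (sw π w) ↔ F.E (π l) (π m) w)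
    {p : CylNode n W} (hp : Valid F G sw p) (l m : Fin n) :
    seq F p l = seq F p m ↔ F.E l m p.label := by
  induction p generalizing l m with
  | root w => simp [seq, rep_eq_iff, label]
  | step p π k w ih =>
    obtain ⟨hp, hπ, hT⟩ := hp
    have key : ∀ l m, l ≠ k → m ≠ k → (seq F p (π l) = seq F p (π m) ↔ F.E l m w) := by
      intro l m hl hm
      rw [ih hp, ← hE π hπ]
      exact ⟨F.E_of_T hl.symm hm.symm hT, F.E_of_T hl.symm hm.symm (F.T_symm hT)⟩
    have key' : ∀ m, m ≠ k → (seq F (step p π k w) k = seq F p (π m) ↔ F.E k m w) := by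
      intro m hm
      by_cases h : ∃ j, j ≠ k ∧ F.E k j w
      · obtain ⟨j, hj, hjE, hs⟩ := seq_step_self p π h
        rw [hs, key j m hj hm]
        exact ⟨F.E_trans hjE, F.E_trans (F.E_symm hjE)⟩
      · rw [seq_step_new p π h]
        constructor
        · intro h'
          have := isPrefix_seq (F := F) p (π m)
          rw [← h'] at this
          exact absurd this (not_isPrefix_step p π k w)
        · intro h'
          exact absurd ⟨m, hm, h'⟩ h
    change _ ↔ F.E l m w
    by_cases hl : l = k <;> by_cases hm : m = k
    · subst hl; subst hm
      exact iff_of_true rfl (F.E_refl _ _)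
    · subst hl
      rw [seq_step_of_ne p π w hm, key' m hm]
    · subst hm
      rw [seq_step_of_ne p π w hl, eq_comm, key' l hl]
      exact ⟨F.E_symm, F.E_symm⟩
    · rw [seq_step_of_ne p π w hl, seq_step_of_ne p π w hm, key l m hl hm]

/-- If the values of `p` at the positions `τ` occur in a node that does not extend `p`, then they
occur in the predecessor of `p`. -/
theorem exists_linked_of_not_isPrefix
    (hE : ∀ π ∈ G, ∀ w l m, F.E l m (sw π w) ↔ F.E (π l) (π m) w)
    (hn : 2 ≤ n) {p q : CylNode n W} (hp : Valid F G sw p)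
    {i : Fin n} {τ ρ : Fin n → Fin n} (h : ∀ l, l ≠ i → seq F p (τ l) = seq F q (ρ l))
    (hpq : ¬ p.IsPrefix q) :
    ∃ p' τ', Valid F G sw p' ∧ p'.depth < p.depth ∧
      (∀ l, l ≠ i → seq F p' (τ' l) = seq F q (ρ l)) ∧
      F.Linked G sw i (p'.label, τ') (p.label, τ) := by
  -- A tracked value created at `p` itself would make `p` a prefix of `q`.
  have hne : ∀ l, l ≠ i → (seq F p (τ l)).1 ≠ p := by
    intro l hl h'
    have := isPrefix_seq (F := F) q (ρ l)
    rw [← h l hl, h'] at this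
    exact hpq this
  cases p with
  | root w =>
    have : Nontrivial (Fin n) := Fin.nontrivial_iff_two_le.2 hn
    obtain ⟨l, hl⟩ := exists_ne i
    exact absurd rfl (hne l hl)
  | step p π k w =>
    -- Hence every tracked value was already present before the last step, at a position that this
    -- step left in place.
    have hσ : ∀ l, l ≠ i → ∃ j, j ≠ k ∧ seq F (step p π k w) (τ l) = seq F p (π j) := by
      intro l hl
      by_cases hk : τ l = k
      · by_cases hex : ∃ j, j ≠ k ∧ F.E k j w
        · obtain ⟨j, hj, -, hs⟩ := seq_step_self p π hex
          exact ⟨j, hj, hk ▸ hs⟩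
        · refine absurd ?_ (hne l hl)
          rw [hk, seq_step_new p π hex]
      · exact ⟨τ l, hk, seq_step_of_ne p π w hk⟩
    choose! σ hσk hσ using hσ
    refine ⟨p, π ∘ σ, hp.1, Nat.lt_succ_self _, fun l hl => ?_, ?_⟩
    · rw [← h l hl, hσ l hl]
      rfl
    · refine .head (.perm π hp.2.1 p.label σ) (.head (.slide k _ w σ hp.2.2 hσk)
        (.single (.relabel w σ τ fun l hl => ?_)))
      refine (seq_eq_iff hE hp _ _).1 ?_
      rw [hσ l hl, seq_step_of_ne p π w (hσk l hl)]

/-- Induction on the total depth: a node that is not a prefix of the other can be shortened, and two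
nodes that are prefixes of each other coincide. -/
theorem linked_of_seq_eq
    (hE : ∀ π ∈ G, ∀ w l m, F.E l m (sw π w) ↔ F.E (π l) (π m) w)
    (hn : 2 ≤ n) (i : Fin n) (N : ℕ) (p q : CylNode n W)
    (τ ρ : Fin n → Fin n) (hN : p.depth + q.depth ≤ N) (hp : Valid F G sw p)
    (hq : Valid F G sw q) (h : ∀ l, l ≠ i → seq F p (τ l) = seq F q (ρ l)) :
    F.Linked G sw i (p.label, τ) (q.label, ρ) := by
  induction N using Nat.strong_induction_on generalizing p q τ ρ with
  | _ N ih =>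
    by_cases hpq : p.IsPrefix q
    · by_cases hqp : q.IsPrefix p
      · obtain rfl := hpq.antisymm hqp
        exact .single (.relabel _ _ _ fun l hl => (seq_eq_iff hE hp _ _).1 (h l hl))
      · obtain ⟨q', ρ', hq', hd, h', hl⟩ :=
          exists_linked_of_not_isPrefix hE hn hq (fun l hl => (h l hl).symm) hqp
        exact (ih _ (by omega) p q' τ ρ' le_rfl hp hq' fun l hl => (h' l hl).symm).trans hl
    · obtain ⟨p', τ', hp', hd, h', hl⟩ := exists_linked_of_not_isPrefix hE hn hp h hpq
      exact hl.symm.trans (ih _ (by omega) p' q τ' ρ le_rfl hp' hq h')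

end CylNode

/-! ### Representing a frame in which links entail its relations. -/

namespace CylFrame

variable {n : ℕ} {W : Type u} (F : CylFrame n W) (G : Subgroup (Equiv.Perm (Fin n)))
  (sw : Equiv.Perm (Fin n) → W → W)

/-- A frame in which links entail the relations of the frame is representable, by a set of
sequences closed under the permutations in `G`. -/
theorem exists_rep_of_linked (hn : 2 ≤ n) (h1 : ∀ w, sw 1 w = w)
    (hE : ∀ π ∈ G, ∀ w l m, F.E l m (sw π w) ↔ F.E (π l) (π m) w)
    (hL : ∀ i w w', F.Linked G sw i (w, id) (w', id) → F.T i w w') :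
    ∃ R : FrameRep F, ∀ f ∈ R.V, ∀ π ∈ G, f ∘ π ∈ R.V := by
  classical
  have hagree : ∀ p q : CylNode n W, p.Valid F G sw → q.Valid F G sw → ∀ π ∈ G, ∀ ρ ∈ G, ∀ i,
      (∀ l, l ≠ i → p.seq F (π l) = q.seq F (ρ l)) → F.T i (sw π p.label) (sw ρ q.label) := by
    intro p q hp hq π hπ ρ hρ i h
    refine hL _ _ _ (.head (.permSymm π hπ _ id) (.tail ?_ (.perm ρ hρ _ id)))
    exact CylNode.linked_of_seq_eq hE hn i _ p q _ _ le_rfl hp hq h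
  have hdiag : ∀ p : CylNode n W, p.Valid F G sw → ∀ π ∈ G, ∀ l m,
      p.seq F (π l) = p.seq F (π m) ↔ F.E l m (sw π p.label) := by
    intro p hp π hπ l m
    rw [CylNode.seq_eq_iff hE hp, hE π hπ]
  -- This makes the label well defined. An injective sequence determines its node and permutation;
  -- if two coordinates coincide, `eq_of_T` identifies the labels.
  have huniq : ∀ p q : CylNode n W, p.Valid F G sw → q.Valid F G sw → ∀ π ∈ G, ∀ ρ ∈ G,
      p.seq F ∘ π = q.seq F ∘ ρ → sw π p.label = sw ρ q.label := by
    intro p q hp hq π hπ ρ hρ h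
    by_cases hinj : ∀ l m, F.E l m (sw π p.label) → l = m
    · have hs : Function.Injective (p.seq F ∘ π) := fun l m hlm =>
        hinj _ _ ((hdiag p hp π hπ l m).1 hlm)
      have hs' : Function.Injective (q.seq F ∘ ρ) := h ▸ hs
      have hs1 : Function.Injective (p.seq F) := (Function.Injective.of_comp_iff' _ π.bijective).1 hs
      have hs2 : Function.Injective (q.seq F) :=
        (Function.Injective.of_comp_iff' _ ρ.bijective).1 hs'
      have hpq : p = q := CylNode.IsPrefix.antisymm
        (CylNode.isPrefix_of_injective hn h fun l m hlm =>
          hs1 ((CylNode.seq_eq_iff hE hp l m).2 hlm))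
        (CylNode.isPrefix_of_injective hn h.symm fun l m hlm =>
          hs2 ((CylNode.seq_eq_iff hE hq l m).2 hlm))
      subst hpq
      have : π = ρ := Equiv.ext fun l => hs1 (congrFun h l)
      rw [this]
    · push Not at hinj
      obtain ⟨l, m, hlm, hne⟩ := hinj
      refine F.eq_of_T hne hlm ?_ (hagree p q hp hq π hπ ρ hρ l fun x _ => congrFun h x)
      rw [← hdiag p hp π hπ] at hlm
      rw [← hdiag q hq ρ hρ]
      have hl := congrFun h l
      have hm := congrFun h m
      simp only [Function.comp_apply] at hl hm
      rw [← hl, ← hm, hlm]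
  let good : (Fin n → CylNode n W × Fin n) → CylNode n W × Equiv.Perm (Fin n) → Prop :=
    fun f x => x.1.Valid F G sw ∧ x.2 ∈ G ∧ x.1.seq F ∘ x.2 = f
  let lab : (Fin n → CylNode n W × Fin n) → W := fun f =>
    -- Outside the set of sequences the label is irrelevant; reading it off `f` avoids assuming a
    -- point of `W`.
    if h : ∃ x, good f x then sw h.choose.2 h.choose.1.label else (f ⟨0, by omega⟩).1.label
  have hlab : ∀ p : CylNode n W, p.Valid F G sw → ∀ π ∈ G,
      lab (p.seq F ∘ π) = sw π p.label := by
    intro p hp π hπ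
    have h : ∃ x, good (p.seq F ∘ π) x := ⟨(p, π), hp, hπ, rfl⟩
    have hx := h.choose_spec
    simp only [lab, dif_pos h]
    exact huniq _ _ hx.1 hp _ hx.2.1 _ hπ hx.2.2
  refine ⟨{ U := CylNode n W × Fin n
            V := {f | ∃ x, good f x}
            label := lab
            diag_iff := ?_
            T_of_agree := ?_
            exists_agree := ?_
            exists_label := ?_ }, ?_⟩
  · rintro _ ⟨⟨p, π⟩, hp, hπ, rfl⟩ l m
    rw [hlab p hp π hπ]
    exact hdiag p hp π hπ l m
  · rintro _ ⟨⟨p, π⟩, hp, hπ, rfl⟩ _ ⟨⟨q, ρ⟩, hq, hρ, rfl⟩ i h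
    rw [hlab p hp π hπ, hlab q hq ρ hρ]
    exact hagree p q hp hq π hπ ρ hρ i h
  · rintro _ ⟨⟨p, π⟩, hp, hπ, rfl⟩ i w hT
    rw [hlab p hp π hπ] at hT
    have hv : (CylNode.step p π i w).Valid F G sw := ⟨hp, hπ, hT⟩
    refine ⟨(CylNode.step p π i w).seq F ∘ (1 : Equiv.Perm (Fin n)),
      ⟨(_, 1), hv, G.one_mem, rfl⟩, ?_, fun l hl => ?_⟩
    · rw [hlab _ hv 1 G.one_mem, h1]
      rfl
    · exact CylNode.seq_step_of_ne p π w hl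
  · intro w
    have hv : (CylNode.root w : CylNode n W).Valid F G sw := trivial
    refine ⟨_, ⟨(CylNode.root w, 1), hv, G.one_mem, rfl⟩, ?_⟩
    rw [hlab _ hv 1 G.one_mem, h1]
    rfl
  · rintro _ ⟨⟨p, π⟩, hp, hπ, rfl⟩ ρ hρ
    exact ⟨(p, π * ρ), hp, G.mul_mem hπ hρ, rfl⟩

end CylFrame

/-- A self-map of a finite set omits a value if one argument is left out. -/
theorem exists_forall_ne_apply {n : ℕ} (i : Fin n) (τ : Fin n → Fin n) :
    ∃ a, ∀ l, l ≠ i → τ l ≠ a := by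
  by_contra hc
  push Not at hc
  have h1 : (Finset.univ : Finset (Fin n)) ⊆ (Finset.univ.erase i).image τ := by
    intro a _
    obtain ⟨l, hl, rfl⟩ := hc a
    exact Finset.mem_image_of_mem _ (Finset.mem_erase.2 ⟨hl, Finset.mem_univ _⟩)
  have h2 := (Finset.card_le_card h1).trans Finset.card_image_le
  rw [Finset.card_erase_of_mem (Finset.mem_univ _), Finset.card_univ, Fintype.card_fin] at h2
  have := i.2
  omega

/-! ### Transpositions and closure under permutations. -/

namespace CylFrame

variable {n : ℕ} {W : Type u} (F : CylFrame n W)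

/-- `u` is obtained from `w` by the substitution `[i/j]`. -/
def Sub (i j : Fin n) (w u : W) : Prop := F.T i w u ∧ F.E i j u

/-- The substitutions by which the transposition of `i` and `j` leads from `v` to `w` up to any
one coordinate. -/
def SwapLike (i j : Fin n) (v w : W) : Prop :=
  (∃ u, F.Sub i j v u ∧ F.T j u w) ∧ (∃ u, F.Sub j i v u ∧ F.T i u w) ∧
    ∀ k, k ≠ i → k ≠ j → ∃ u₁ u₂ u₃, F.Sub k i v u₁ ∧ F.Sub i j u₁ u₂ ∧ F.Sub j k u₂ u₃ ∧
      F.T k u₃ w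

variable {F}

theorem SwapLike.symm {i j : Fin n} {v w : W} (h : F.SwapLike i j v w) : F.SwapLike j i w v := by
  obtain ⟨⟨u, ⟨hu1, hu2⟩, hu3⟩, ⟨u', ⟨hu1', hu2'⟩, hu3'⟩, h⟩ := h
  refine ⟨⟨u, ⟨F.T_symm hu3, F.E_symm hu2⟩, F.T_symm hu1⟩,
    ⟨u', ⟨F.T_symm hu3', F.E_symm hu2'⟩, F.T_symm hu1'⟩, fun k hk hk' => ?_⟩
  obtain ⟨u₁, u₂, u₃, h1, h2, h3, h4⟩ := h k hk' hk
  exact ⟨u₃, u₂, u₁, ⟨F.T_symm h4, F.E_symm h3.2⟩, ⟨F.T_symm h3.1, F.E_symm h2.2⟩,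
    ⟨F.T_symm h2.1, F.E_symm h1.2⟩, F.T_symm h1.1⟩

end CylFrame

namespace FrameRep

variable {n : ℕ} {W : Type u} {F : CylFrame n W} (R : FrameRep F)

/-- The sequences `g ∘ π`, for `g` labelled by `w`, agree up to any given coordinate with
sequences labelled by `v`. -/
def Transfers (π : Equiv.Perm (Fin n)) (w v : W) : Prop :=
  ∀ g ∈ R.V, R.label g = w → ∀ a, ∃ g' ∈ R.V, R.label g' = v ∧ ∀ l, l ≠ a → g' l = g (π l)

/-- As far as relations between fewer than all coordinates are concerned, `v` is `w`, permuted
by `π`. -/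
structure Partner (π : Equiv.Perm (Fin n)) (w v : W) : Prop where
  E_iff : ∀ l m, F.E l m v ↔ F.E (π l) (π m) w
  transfers : R.Transfers π w v
  transfers_symm : R.Transfers π.symm v w

variable {R}

/-- The coordinate `a` exempted for the product must be exempted as `ρ a` in the first transfer. -/
theorem Transfers.mul {π ρ : Equiv.Perm (Fin n)} {w v u : W} (h : R.Transfers π w v)
    (h' : R.Transfers ρ v u) : R.Transfers (π * ρ) w u := by
  intro g hg hgw a
  obtain ⟨g', hg', hg'v, hgg'⟩ := h g hg hgw (ρ a)
  obtain ⟨g'', hg'', hg''u, hg'g''⟩ := h' g' hg' hg'v a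
  refine ⟨g'', hg'', hg''u, fun l hl => ?_⟩
  rw [hg'g'' l hl, hgg' _ (ρ.injective.ne hl)]
  rfl

theorem Transfers.refl (w : W) : R.Transfers 1 w w :=
  fun g hg hgw _ => ⟨g, hg, hgw, fun _ _ => rfl⟩

theorem Partner.mul {π ρ : Equiv.Perm (Fin n)} {w v u : W} (h : R.Partner π w v)
    (h' : R.Partner ρ v u) : R.Partner (π * ρ) w u :=
  ⟨fun l m => (h'.E_iff l m).trans (h.E_iff _ _), h.transfers.mul h'.transfers,
    h'.transfers_symm.mul h.transfers_symm⟩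

theorem Partner.refl (w : W) : R.Partner 1 w w :=
  ⟨fun _ _ => Iff.rfl, .refl w, .refl w⟩

/-- If `u` is obtained from the label of `g` by `[i/j]`, then `g ∘ [i/j]` is labelled by `u`. -/
theorem exists_sub {g : Fin n → R.U} (hg : g ∈ R.V) {i j : Fin n} {u : W}
    (h : F.Sub i j (R.label g) u) :
    ∃ g' ∈ R.V, R.label g' = u ∧ g' i = g' j ∧ ∀ l, l ≠ i → g' l = g l := by
  obtain ⟨g', hg', hu, hgg'⟩ := R.exists_agree g hg i u h.1
  exact ⟨g', hg', hu, (R.diag_iff g' hg' i j).2 (hu ▸ h.2), hgg'⟩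

/-- The exempted coordinate is scratch space: if it is `i` or `j`, one substitution suffices;
otherwise it stores one of the two values during the exchange. -/
theorem transfers_of_swapLike {i j : Fin n} (hij : i ≠ j) {v w : W} (h : F.SwapLike i j v w) :
    R.Transfers (Equiv.swap i j) v w := by
  rintro g hg rfl a
  obtain ⟨⟨u, hu, hu'⟩, ⟨u', hv, hv'⟩, h⟩ := h
  by_cases haj : a = j
  · subst haj
    obtain ⟨g₁, hg₁, rfl, e₁, e₁'⟩ := exists_sub hg hu
    obtain ⟨g₂, hg₂, hw, e₂⟩ := R.exists_agree g₁ hg₁ a w hu'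
    refine ⟨g₂, hg₂, hw, fun l hl => ?_⟩
    rw [e₂ l hl]
    by_cases hli : l = i
    · rw [hli, Equiv.swap_apply_left, e₁, e₁' a hij.symm]
    · rw [Equiv.swap_apply_of_ne_of_ne hli hl, e₁' l hli]
  by_cases hai : a = i
  · subst hai
    obtain ⟨g₁, hg₁, rfl, e₁, e₁'⟩ := exists_sub hg hv
    obtain ⟨g₂, hg₂, hw, e₂⟩ := R.exists_agree g₁ hg₁ a w hv'
    refine ⟨g₂, hg₂, hw, fun l hl => ?_⟩
    rw [e₂ l hl]
    by_cases hlj : l = j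
    · rw [hlj, Equiv.swap_apply_right, e₁, e₁' a hij]
    · rw [Equiv.swap_apply_of_ne_of_ne hl hlj, e₁' l hlj]
  obtain ⟨u₁, u₂, u₃, h₁, h₂, h₃, h₄⟩ := h a hai haj
  obtain ⟨g₁, hg₁, rfl, e₁, e₁'⟩ := exists_sub hg h₁
  obtain ⟨g₂, hg₂, rfl, e₂, e₂'⟩ := exists_sub hg₁ h₂
  obtain ⟨g₃, hg₃, rfl, e₃, e₃'⟩ := exists_sub hg₂ h₃
  obtain ⟨g₄, hg₄, hw, e₄⟩ := R.exists_agree g₃ hg₃ a w h₄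
  refine ⟨g₄, hg₄, hw, fun l hl => ?_⟩
  rw [e₄ l hl]
  by_cases hli : l = i
  · rw [hli, Equiv.swap_apply_left, e₃' i hij, e₂, e₂' j hij.symm, e₁' j (Ne.symm haj)]
  by_cases hlj : l = j
  · rw [hlj, Equiv.swap_apply_right, e₃, e₃' a haj, e₂' a hai, e₁, e₁' i (Ne.symm hai)]
  rw [Equiv.swap_apply_of_ne_of_ne hli hlj, e₃' l hlj, e₂' l hli, e₁' l hl]

theorem partner_of_swapLike {i j : Fin n} (hij : i ≠ j) {v w : W} (h : F.SwapLike i j v w)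
    (hE : n = 2 → ∀ l m, F.E l m v ↔ F.E (Equiv.swap i j l) (Equiv.swap i j m) w) :
    R.Partner (Equiv.swap i j) w v := by
  have h' : R.Transfers (Equiv.swap i j) w v := by
    rw [Equiv.swap_comm]
    exact transfers_of_swapLike hij.symm h.symm
  refine ⟨fun l m => ?_, h', by rw [Equiv.symm_swap]; exact transfers_of_swapLike hij h⟩
  by_cases hn : n = 2
  · exact hE hn l m
  have hn : 2 < n := by
    have h1 := i.2
    have h2 := j.2
    have h3 : (i : ℕ) ≠ j := fun h => hij (Fin.ext h)
    omega
  -- With a third coordinate to exempt, `l` and `m` are transferred faithfully; for `n = 2` there is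
  -- none, whence the hypothesis `hE`.
  obtain ⟨a, ha⟩ : ∃ a, a ∉ ({l, m} : Finset (Fin n)) := by
    by_contra hc
    push Not at hc
    have h1 := Finset.card_le_card (fun a _ => hc a : Finset.univ ⊆ ({l, m} : Finset (Fin n)))
    have h2 := Finset.card_le_two (a := l) (b := m)
    simp only [Finset.card_univ, Fintype.card_fin] at h1
    omega
  simp only [Finset.mem_insert, Finset.mem_singleton, not_or] at ha
  obtain ⟨g, hg, hgw⟩ := R.exists_label w
  obtain ⟨g', hg', rfl, e⟩ := h' g hg hgw a
  subst hgw
  rw [← R.diag_iff g' hg', ← R.diag_iff g hg, e l (Ne.symm ha.1), e m (Ne.symm ha.2)]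

/-- A representable frame in which every point has a partner under every transposition is
representable by a set of sequences closed under all permutations. -/
theorem exists_permutable (R : FrameRep F) (hn : 2 ≤ n)
    (h : ∀ i j : Fin n, i ≠ j → ∀ w, ∃ v, R.Partner (Equiv.swap i j) w v) :
    ∃ R' : FrameRep F, ∀ f ∈ R'.V, ∀ π : Equiv.Perm (Fin n), f ∘ π ∈ R'.V := by
  have hall : ∀ π : Equiv.Perm (Fin n), ∀ w, ∃ v, R.Partner π w v := by
    intro π
    induction π using Equiv.Perm.swap_induction_on with
    | one => exact fun w => ⟨w, .refl w⟩
    | swap_mul π i j hij ih =>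
      intro w
      obtain ⟨v, hv⟩ := h i j hij w
      obtain ⟨u, hu⟩ := ih v
      exact ⟨u, hv.mul hu⟩
  -- The unravelling needs `sw 1` to be the identity, so the partner under `1` is fixed by hand.
  have hall' : ∀ π : Equiv.Perm (Fin n), ∀ w, ∃ v, R.Partner π w v ∧ (π = 1 → v = w) := by
    intro π w
    by_cases hπ : π = 1
    · exact ⟨w, hπ ▸ .refl w, fun _ => rfl⟩
    · obtain ⟨v, hv⟩ := hall π w
      exact ⟨v, hv, fun h => absurd h hπ⟩
  choose sw hsw hsw1 using hall'
  suffices hlink : ∀ i w w', F.Linked ⊤ sw i (w, id) (w', id) → F.T i w w' by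
    obtain ⟨R', hR'⟩ := F.exists_rep_of_linked ⊤ sw hn (fun w => hsw1 1 w rfl)
      (fun π _ w => (hsw π w).E_iff) hlink
    exact ⟨R', fun f hf π => hR' f hf π trivial⟩
  intro i w w' hL
  obtain ⟨f, hf, rfl⟩ := R.exists_label w
  -- Invariant: in the given representation some sequence labelled by the current point holds the
  -- values of `f` at the tracked positions.
  suffices hstep : ∀ s t, F.Move ⊤ sw i s t →
      (∃ g ∈ R.V, R.label g = s.1 ∧ ∀ l, l ≠ i → f l = g (s.2 l)) →
      ∃ g ∈ R.V, R.label g = t.1 ∧ ∀ l, l ≠ i → f l = g (t.2 l) by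
    obtain ⟨g, hg, rfl, hfg⟩ := hL.induct hstep ⟨f, hf, rfl, fun _ _ => rfl⟩
    exact R.T_of_agree f hf g hg i hfg
  rintro _ _ (⟨k, w, w', τ, hT, hk⟩ | ⟨w, τ, τ', hE⟩ | ⟨π, -, w, τ⟩ | ⟨π, -, w, τ⟩)
    ⟨g, hg, hgw, hfg⟩ <;> dsimp only at hgw hfg
  · obtain ⟨g', hg', hg'w, e⟩ := R.exists_agree g hg k w' (hgw ▸ hT)
    exact ⟨g', hg', hg'w, fun l hl => by rw [hfg l hl, e _ (hk l hl)]⟩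
  · refine ⟨g, hg, hgw, fun l hl => ?_⟩
    rw [hfg l hl, R.diag_iff g hg, hgw]
    exact hE l hl
  -- A partner is exact only off one coordinate; an untracked one is exempted.
  · obtain ⟨a, ha⟩ := exists_forall_ne_apply i τ
    obtain ⟨g', hg', hg'w, e⟩ := (hsw π w).transfers g hg hgw a
    exact ⟨g', hg', hg'w, fun l hl => by rw [hfg l hl, e _ (ha l hl)]; rfl⟩
  · obtain ⟨a, ha⟩ := exists_forall_ne_apply i (π ∘ τ)
    obtain ⟨g', hg', hg'w, e⟩ := (hsw π w).transfers_symm g hg hgw a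
    refine ⟨g', hg', hg'w, fun l hl => ?_⟩
    dsimp only
    rw [hfg l hl, e _ (ha l hl), Function.comp_apply, Equiv.symm_apply_apply]

end FrameRep

/-! ### Prime filters as points. -/

/-- A set of prime filters of a Boolean algebra that is rich enough to realize every monotone
map. -/
structure PointSystem (A : Type u) [BooleanAlgebra A] (W : Type u) where
  val : W → BoundedLatticeHom A Prop
  val_injective : Function.Injective val
  exists_val : ∀ x, x ≠ ⊥ → ∃ w, val w x
  exists_realizer : ∀ w (φ : A → A), Monotone φ → (∀ x, val w x → φ x ≠ ⊥) →
    ∃ v, ∀ x, val w x → val v (φ x)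

section Points

variable {A : Type u} [BooleanAlgebra A]

/-- The complement of a prime ideal disjoint from the filter generated by `S`. -/
theorem exists_hom_of_directedOn {S : Set A} (hS : S.Nonempty) (hd : DirectedOn (· ≥ ·) S)
    (hb : ⊥ ∉ S) : ∃ h : BoundedLatticeHom A Prop, ∀ x ∈ S, h x := by
  have hF : Order.IsPFilter {y | ∃ x ∈ S, x ≤ y} := by
    refine .of_def ?_ ?_ ?_
    · exact hS.imp fun x hx => ⟨x, hx, le_rfl⟩
    · rintro y ⟨x, hx, hxy⟩ y' ⟨x', hx', hxy'⟩
      obtain ⟨z, hz, h, h'⟩ := hd x hx x' hx'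
      exact ⟨z, ⟨z, hz, le_rfl⟩, le_trans h hxy, le_trans h' hxy'⟩
    · rintro y z hyz ⟨x, hx, hxy⟩
      exact ⟨x, hx, hxy.trans hyz⟩
  obtain ⟨J, hJ, -, hdis⟩ := DistribLattice.prime_ideal_of_disjoint_filter_ideal
    (F := hF.toPFilter) (I := (⊥ : Order.Ideal A)) (by
      rw [Set.disjoint_left]
      rintro y ⟨x, hx, hxy⟩ hy
      have hy : y = ⊥ := le_bot_iff.1 (Order.Ideal.mem_principal.1 hy)
      exact hb (le_bot_iff.1 (hxy.trans hy.le) ▸ hx))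
  have htop : (⊤ : A) ∉ J := hJ.toIsProper.top_notMem
  refine ⟨{ toFun := fun x => x ∉ J
            map_sup' := fun x y => ?_
            map_inf' := fun x y => ?_
            map_top' := ?_
            map_bot' := ?_ }, fun x hx hxJ => ?_⟩
  · simp only [Order.Ideal.sup_mem_iff, sup_Prop_eq, eq_iff_iff]
    tauto
  · simp only [inf_Prop_eq, eq_iff_iff]
    constructor
    · exact fun h => ⟨fun hx => h (J.lower inf_le_left hx), fun hy => h (J.lower inf_le_right hy)⟩
    · exact fun h h' => (hJ.mem_or_mem h').elim h.1 h.2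
  · simpa using htop
  · simp
  · exact Set.disjoint_left.1 hdis ⟨x, hx, le_rfl⟩ hxJ

/-- All prime filters. -/
def PointSystem.all (A : Type u) [BooleanAlgebra A] :
    PointSystem A (BoundedLatticeHom A Prop) where
  val w := w
  val_injective _ _ h := h
  exists_val x hx := by
    obtain ⟨h, hh⟩ := exists_hom_of_directedOn (S := {x}) (Set.singleton_nonempty x)
      (directedOn_singleton x) (fun h => hx h.symm)
    exact ⟨h, hh x rfl⟩
  exists_realizer w φ hφ hne := by
    obtain ⟨h, hh⟩ := exists_hom_of_directedOn (S := φ '' {x | w x})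
      ⟨φ ⊤, ⊤, by simp, rfl⟩ (by
        rintro _ ⟨x, hx, rfl⟩ _ ⟨y, hy, rfl⟩
        refine ⟨φ (x ⊓ y), ⟨x ⊓ y, ?_, rfl⟩, hφ inf_le_left, hφ inf_le_right⟩
        simp only [Set.mem_ofPred_eq, map_inf]
        exact ⟨hx, hy⟩) (by
        rintro ⟨x, hx, hx'⟩
        exact hne x hx hx')
    exact ⟨h, fun x hx => hh _ ⟨x, hx, rfl⟩⟩

/-- If the atom is below no member of `S`, its complement bounds `S`. Completeness of the
representation in (b) rests on this. -/
theorem IsAtom.le_isLUB_iff {a : A} (ha : IsAtom a) {S : Set A} {b : A} (hb : IsLUB S b) :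
    a ≤ b ↔ ∃ x ∈ S, a ≤ x := by
  constructor
  · intro h
    by_contra hc
    push Not at hc
    have hle : b ≤ aᶜ := hb.2 fun x hx =>
      le_compl_iff_disjoint_left.2 (ha.not_le_iff_disjoint.1 (hc x hx))
    exact ha.1 (disjoint_self.1 (le_compl_iff_disjoint_left.1 (h.trans hle)))
  · rintro ⟨x, hx, h⟩
    exact h.trans (hb.1 hx)

/-- The prime filters generated by the atoms. -/
def PointSystem.atoms (A : Type u) [BooleanAlgebra A] [IsAtomic A] :
    PointSystem A {a : A // IsAtom a} where
  val a :=
    { toFun := fun x => (a : A) ≤ x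
      map_sup' := fun x y => by simp [a.2.le_isLUB_iff isLUB_pair]
      map_inf' := fun x y => propext le_inf_iff
      map_top' := by simp
      map_bot' := by simpa using a.2.1 }
  val_injective a b h := by
    have h1 : ((a : A) ≤ a) = ((b : A) ≤ a) := DFunLike.congr_fun h (a : A)
    have h2 : ((a : A) ≤ b) = ((b : A) ≤ b) := DFunLike.congr_fun h (b : A)
    exact Subtype.ext (le_antisymm (h2.mpr le_rfl) (h1.mp le_rfl))
  exists_val x hx := by
    obtain ⟨a, ha, hax⟩ := (eq_bot_or_exists_atom_le x).resolve_left hx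
    exact ⟨⟨a, ha⟩, hax⟩
  exists_realizer w φ hφ hne := by
    -- The filter has a least element `w`, so an atom below `φ w` serves for all `x` at once.
    obtain ⟨a, ha, haw⟩ := (eq_bot_or_exists_atom_le (φ w)).resolve_left (hne _ le_rfl)
    exact ⟨⟨a, ha⟩, fun x hx => haw.trans (hφ hx)⟩

namespace PointSystem

variable {W : Type u} (P : PointSystem A W)

theorem val_mono {w : W} {x y : A} (h : x ≤ y) (hx : P.val w x) : P.val w y :=
  OrderHomClass.mono (P.val w) h hx

theorem val_inf {w : W} {x y : A} : P.val w (x ⊓ y) ↔ P.val w x ∧ P.val w y := by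
  simp

theorem val_top (w : W) : P.val w ⊤ := by
  simp

theorem not_val_bot (w : W) : ¬ P.val w ⊥ := by
  simp

theorem ne_bot {w : W} {x : A} (h : P.val w x) : x ≠ ⊥ :=
  fun hx => P.not_val_bot w (hx ▸ h)

theorem val_compl {w : W} {x : A} : P.val w xᶜ ↔ ¬ P.val w x := by
  constructor
  · intro h h'
    exact P.not_val_bot w (inf_compl_self x ▸ P.val_inf.2 ⟨h', h⟩)
  · intro h
    have := P.val_top w
    rw [← sup_compl_eq_top (x := x)] at this
    simp only [map_sup, sup_Prop_eq] at this
    exact this.resolve_left h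

end PointSystem

end Points

theorem replIter_congr {n : ℕ} {I J I' J' : ℕ → Fin n} {m : ℕ}
    (h : ∀ t < m, I t = I' t ∧ J t = J' t) : replIter I J m = replIter I' J' m := by
  induction m with
  | zero => rfl
  | succ m ih =>
    obtain ⟨h1, h2⟩ := h m (Nat.lt_succ_self m)
    simp only [replIter, h1, h2, ih fun t ht => h t (Nat.lt_succ_of_lt ht)]

/-! ### The frame of an algebra, and axiom (7). -/

namespace CylOps

variable {n : ℕ} {A : Type u} [BooleanAlgebra A] {O : CylOps n A}

namespace IsRC

theorem c_top (hO : O.IsRC) (i : Fin n) : O.c i ⊤ = ⊤ := top_le_iff.1 (hO.ax2 i ⊤)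

theorem c_c (hO : O.IsRC) (i : Fin n) (x : A) : O.c i (O.c i x) = O.c i x := by
  simpa [hO.c_top] using hO.ax3 i ⊤ x

theorem c_mono (hO : O.IsRC) (i : Fin n) : Monotone (O.c i) := by
  intro x y h
  rw [← inf_eq_left.2 (h.trans (hO.ax2 i y)), hO.ax3]
  exact inf_le_right

theorem s_mono (hO : O.IsRC) (i j : Fin n) : Monotone (O.s i j) := by
  intro x y h
  unfold s
  split_ifs
  · exact h
  · exact hO.c_mono i (inf_le_inf_right _ h)

variable {W : Type u}

/-- The points of an algebra in `RC_n`, with the relations that its operations induce. -/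
def frame (hO : O.IsRC) (P : PointSystem A W) : CylFrame n W where
  T i w w' := ∀ x, P.val w' x → P.val w (O.c i x)
  E i j w := P.val w (O.d i j)
  T_refl i _ x := P.val_mono (hO.ax2 i x)
  -- Otherwise `w` contains both `c_i(-c_i x)` and `c_i x`, whose meet is `c_i(-c_i x · c_i x) = 0`.
  T_symm {i w w'} h x hx := by
    by_contra hc
    refine P.not_val_bot w ?_
    rw [← hO.ax1 i, ← compl_inf_eq_bot (a := O.c i x), hO.ax3]
    exact P.val_inf.2 ⟨h _ (P.val_compl.2 hc), P.val_mono (hO.ax2 i x) hx⟩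
  T_trans {i _ _ _} h h' x hx := hO.c_c i x ▸ h _ (h' _ hx)
  E_refl i w := by
    rw [hO.ax4]
    exact P.val_top w
  E_symm {i j w} h := hO.ax5_symm i j ▸ h
  E_trans {i j k w} h h' := by
    by_cases hi : j = i
    · exact hi ▸ h'
    by_cases hk : j = k
    · exact hk ▸ h
    exact P.val_mono (hO.ax5_trans i k j hi hk) (P.val_inf.2 ⟨h, h'⟩)
  E_of_T {i j k w w'} hi hj h hE := by
    by_contra hc
    refine P.not_val_bot w ?_
    rw [← hO.ax1 k, ← compl_inf_eq_bot (a := O.d i j), hO.ax5_cyl j i k hj hi, hO.ax3,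
      ← hO.ax5_cyl j i k hj hi]
    exact P.val_inf.2 ⟨h _ (P.val_compl.2 hc), hE⟩
  eq_of_T {i j w w'} hij h h' hT := by
    have hsub : ∀ x, P.val w' x → P.val w x := fun x hx =>
      P.val_mono (hO.ax6 i j x hij) (P.val_inf.2 ⟨hT _ (P.val_inf.2 ⟨hx, h'⟩), h⟩)
    refine P.val_injective (DFunLike.ext _ _ fun x => propext ⟨fun hx => ?_, hsub x⟩)
    by_contra hc
    exact P.val_compl.1 (hsub _ (P.val_compl.2 hc)) hx

/-- Realize `x ↦ y · c_i x`: it is nonzero on `w` because applying `c_i` yields `c_i y · c_i x`,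
which lies in `w`. -/
theorem exists_T_of_val_c (hO : O.IsRC) (P : PointSystem A W) {i : Fin n} {w : W} {y : A}
    (h : P.val w (O.c i y)) :
    ∃ v, (hO.frame P).T i w v ∧ P.val v y := by
  obtain ⟨v, hv⟩ := P.exists_realizer w (fun x => y ⊓ O.c i x)
    (fun x x' hx => inf_le_inf_left _ (hO.c_mono i hx)) (fun x hx hb => by
      have := hO.ax3 i y x
      rw [hb, hO.ax1] at this
      exact P.not_val_bot w (this ▸ P.val_inf.2 ⟨h, P.val_mono (hO.ax2 i x) hx⟩))
  refine ⟨v, (hO.frame P).T_symm fun x hx => (P.val_inf.1 (hv x hx)).2, ?_⟩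
  exact (P.val_inf.1 (hv ⊤ (P.val_top w))).1

/-- `u` is reached from `w` by moves along which the coordinates other than `i` are kept at the
positions given by `σ`. -/
def Reach (_ : O.IsRC) (P : PointSystem A W) (i : Fin n) (w u : W) (σ : Fin n → Fin n) : Prop :=
  ∃ (m : ℕ) (I J K : ℕ → Fin n), (∀ t < m, ∀ l, l ≠ i → replIter I J t l ≠ K t) ∧
    replIter I J m = σ ∧ ∀ x, P.val w x → P.val u (O.subIter I J K m x)

end IsRC

theorem subIter_congr {I J K I' J' K' : ℕ → Fin n} {m : ℕ}
    (h : ∀ t < m, I t = I' t ∧ J t = J' t ∧ K t = K' t) (x : A) :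
    O.subIter I J K m x = O.subIter I' J' K' m x := by
  induction m with
  | zero => rfl
  | succ m ih =>
    obtain ⟨h1, h2, h3⟩ := h m (Nat.lt_succ_self m)
    simp only [subIter, h1, h2, h3, ih fun t ht => h t (Nat.lt_succ_of_lt ht)]

namespace IsRC

variable {W : Type u} (hO : O.IsRC) (P : PointSystem A W)

theorem Reach.snoc {i : Fin n} {w u u' : W} {σ : Fin n → Fin n} (h : hO.Reach P i w u σ)
    (a b c : Fin n) (hc : ∀ l, l ≠ i → σ l ≠ c)
    (hu : ∀ y, P.val u y → P.val u' (O.s a b (O.c c y))) :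
    hO.Reach P i w u' (repl a b ∘ σ) := by
  obtain ⟨m, I, J, K, hK, rfl, hx⟩ := h
  have hlt : ∀ t < m, Function.update I m a t = I t ∧ Function.update J m b t = J t ∧
      Function.update K m c t = K t := by
    intro t ht
    simp [Function.update_of_ne ht.ne]
  refine ⟨m + 1, Function.update I m a, Function.update J m b, Function.update K m c, ?_, ?_, ?_⟩
  · intro t ht l hl
    rw [replIter_congr (I' := I) (J' := J) fun s hs =>
      ⟨(hlt s (by omega)).1, (hlt s (by omega)).2.1⟩]
    rcases Nat.lt_succ_iff_lt_or_eq.1 ht with ht | rfl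
    · rw [(hlt t ht).2.2]
      exact hK t ht l hl
    · rw [Function.update_self]
      exact hc l hl
  · simp only [replIter, Function.update_self]
    rw [replIter_congr (I' := I) (J' := J) fun s hs => ⟨(hlt s hs).1, (hlt s hs).2.1⟩]
  · intro x hxw
    simp only [subIter, Function.update_self]
    rw [subIter_congr hlt]
    exact hu _ (hx x hxw)

/-- Axiom (7) enters here: the diagonals at `u` say that all tracked values are back in their
places. -/
theorem Reach.T_of_E {i : Fin n} {w u : W} {σ : Fin n → Fin n} (h : hO.Reach P i w u σ)
    (hE : ∀ l, l ≠ i → (hO.frame P).E l (σ l) u) : (hO.frame P).T i u w := by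
  obtain ⟨m, I, J, K, hK, rfl, hx⟩ := h
  intro x hxw
  -- Axiom (7) does not cover the empty path, where `x ≤ c_i x` suffices.
  rcases Nat.eq_zero_or_pos m with rfl | hm
  · exact P.val_mono (hO.ax2 i x) (hx x hxw)
  · refine P.val_mono (hO.ax7 m I J K i x hm fun t ht => ?_) (P.val_inf.2 ⟨hx x hxw, ?_⟩)
    · intro hmem
      obtain ⟨l, hl, hlK⟩ := Finset.mem_image.1 hmem
      exact hK t ht l (Finset.ne_of_mem_erase hl) hlK
    · rw [map_finset_inf, Finset.inf_eq_iInf, iInf_Prop_eq]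
      intro l
      rw [iInf_Prop_eq]
      exact fun hl => hE l (Finset.ne_of_mem_erase hl)

/-- The positions `σ` produced by actual substitutions need to match the tracked ones only up to the
diagonals of the current point, so relabelling costs nothing. -/
theorem T_of_linked (i : Fin n) (w w' : W)
    (h : (hO.frame P).Linked ⊥ (fun _ w => w) i (w, id) (w', id)) : (hO.frame P).T i w w' := by
  suffices hstep : ∀ s t, (hO.frame P).Move ⊥ (fun _ w => w) i s t →
      (∃ σ, hO.Reach P i w s.1 σ ∧ ∀ l, l ≠ i → (hO.frame P).E (σ l) (s.2 l) s.1) →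
      ∃ σ, hO.Reach P i w t.1 σ ∧ ∀ l, l ≠ i → (hO.frame P).E (σ l) (t.2 l) t.1 by
    obtain ⟨σ, hσ, hσE⟩ := h.induct hstep
      ⟨id, ⟨0, fun _ => i, fun _ => i, fun _ => i, by simp, rfl, fun x hx => hx⟩,
        fun l _ => (hO.frame P).E_refl _ _⟩
    exact (hO.frame P).T_symm (hσ.T_of_E hO P fun l hl => (hO.frame P).E_symm (hσE l hl))
  rintro _ _ (⟨k, u, u', τ, hT, hk⟩ | ⟨u, τ, τ', hE⟩ | ⟨π, hπ, u, τ⟩ | ⟨π, hπ, u, τ⟩)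
    ⟨σ, hσ, hσE⟩ <;> dsimp only at hσ hσE
  · have hT' := (hO.frame P).T_symm hT
    by_cases hex : ∃ l, l ≠ i ∧ σ l = k
    -- Coordinate `k` is occupied under `σ`: the substitution moves its values to `τ l`, where an
    -- equal value sits, before the slide.
    · obtain ⟨l, hl, rfl⟩ := hex
      have hr : ∀ l', l' ≠ i → repl (σ l) (τ l) (σ l') ≠ σ l ∧
          (hO.frame P).E (repl (σ l) (τ l) (σ l')) (τ l') u := by
        intro l' hl'
        by_cases h : σ l' = σ l
        · rw [h, repl, Function.update_self]
          exact ⟨hk l hl, (hO.frame P).E_trans ((hO.frame P).E_symm (hσE l hl)) (h ▸ hσE l' hl')⟩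
        · rw [repl, Function.update_of_ne h]
          exact ⟨h, hσE l' hl'⟩
      -- Each factor in (7) also contains a cylindrification; an unoccupied index makes it harmless.
      obtain ⟨c, hc⟩ : ∃ c, ∀ l, l ≠ i → σ l ≠ c := exists_forall_ne_apply i σ
      refine ⟨_, hσ.snoc hO P (σ l) (τ l) c hc fun y hy => ?_, fun l' hl' =>
        (hO.frame P).E_of_T (hr l' hl').1.symm (hk l' hl').symm hT (hr l' hl').2⟩
      rw [s, if_neg (hk l hl).symm]
      exact hT' _ (P.val_inf.2 ⟨P.val_mono (hO.ax2 c y) hy, hσE l hl⟩)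
    · push Not at hex
      refine ⟨_, hσ.snoc hO P k k k hex fun y hy => ?_, fun l hl => ?_⟩
      · rw [s, if_pos rfl]
        exact hT' y hy
      · have : repl k k = id := Function.update_eq_self k id
        rw [this]
        exact (hO.frame P).E_of_T (hex l hl).symm (hk l hl).symm hT (hσE l hl)
  · exact ⟨σ, hσ, fun l hl => (hO.frame P).E_trans (hσE l hl) (hE l hl)⟩
  · rw [Subgroup.mem_bot] at hπ
    subst hπ
    exact ⟨σ, hσ, hσE⟩
  · rw [Subgroup.mem_bot] at hπ
    subst hπ
    exact ⟨σ, hσ, hσE⟩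

theorem exists_frameRep (hn : 2 ≤ n) : Nonempty (FrameRep (hO.frame P)) := by
  obtain ⟨R, -⟩ := (hO.frame P).exists_rep_of_linked ⊥ (fun _ w => w) hn (fun _ => rfl)
    (fun π hπ w l m => by rw [Subgroup.mem_bot.1 hπ]; rfl) (hO.T_of_linked P)
  exact ⟨R⟩

/-- Each `x` yields a substituted point, and by `eq_of_T` they all coincide. -/
theorem exists_sub_of_forall_val {i j : Fin n} (hij : i ≠ j) {v w : W} {ψ : A → A}
    (h : ∀ x, P.val w x → P.val v (O.s i j (ψ x))) :
    ∃ u, (hO.frame P).Sub i j v u ∧ ∀ x, P.val w x → P.val u (ψ x) := by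
  have key : ∀ x, P.val w x → ∃ u, (hO.frame P).Sub i j v u ∧ P.val u (ψ x) := by
    intro x hx
    have hx := h x hx
    rw [s, if_neg hij] at hx
    obtain ⟨u, hT, hu⟩ := hO.exists_T_of_val_c P hx
    obtain ⟨hu, hE⟩ := P.val_inf.1 hu
    exact ⟨u, ⟨hT, hE⟩, hu⟩
  obtain ⟨u, hu, -⟩ := key ⊤ (P.val_top w)
  refine ⟨u, hu, fun x hx => ?_⟩
  obtain ⟨u', hu', hx'⟩ := key x hx
  rwa [(hO.frame P).eq_of_T hij hu.2 hu'.2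
    ((hO.frame P).T_trans ((hO.frame P).T_symm hu.1) hu'.1)]

end IsRC

theorem IsDC.exists_sub (hO : O.IsDC) {W : Type u} (P : PointSystem A W) {i j : Fin n}
    (hij : i ≠ j) (w : W) : ∃ u, (hO.toIsRC.frame P).Sub i j w u := by
  refine hO.toIsRC.exists_T_of_val_c P (y := O.d i j) ?_
  -- Axiom (9) with equal outer indices reads `c_i d_ij = 1`.
  have h := hO.ax9 j j i hij hij
  rw [hO.ax4, hO.ax5_symm j i, inf_idem] at h
  rw [← h]
  exact P.val_top w

end CylOps

/-! ### Closure under [i/j], and partners from the axioms of SC. -/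

namespace FrameRep

variable {n : ℕ} {W : Type u} {F : CylFrame n W} (R : FrameRep F)

/-- A sequence realizing the substituted point has no choice but to be `f ∘ [i/j]`. -/
theorem diagonalizable (h : ∀ i j : Fin n, i ≠ j → ∀ w, ∃ u, F.Sub i j w u) :
    Diagonalizable R.V := by
  intro f hf i j
  by_cases hij : i = j
  · subst hij
    rwa [repl, show Function.update (id : Fin n → Fin n) i i = id from Function.update_eq_self i id,
      Function.comp_id]
  obtain ⟨u, hu⟩ := h i j hij (R.label f)
  obtain ⟨g, hg, -, e, e'⟩ := exists_sub hf hu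
  convert hg using 1
  funext l
  by_cases hl : l = i
  · rw [hl, e, e' j (Ne.symm hij)]
    simp [repl]
  · rw [e' l hl]
    simp [repl, hl]

variable {R}

theorem Partner.of_E {i j : Fin n} {w : W} (h : F.E i j w) : R.Partner (Equiv.swap i j) w w := by
  have key : ∀ g ∈ R.V, R.label g = w → ∀ l, g (Equiv.swap i j l) = g l := by
    rintro g hg rfl l
    have := (R.diag_iff g hg i j).2 h
    rw [Equiv.swap_apply_def]
    split_ifs with h1 h2
    · rw [h1, this]
    · rw [h2, this]
    · rfl
  have ht : R.Transfers (Equiv.swap i j) w w :=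
    fun g hg hgw a => ⟨g, hg, hgw, fun l _ => (key g hg hgw l).symm⟩
  refine ⟨fun l m => ?_, ht, by rwa [Equiv.symm_swap]⟩
  obtain ⟨g, hg, hgw⟩ := R.exists_label w
  rw [← hgw, ← R.diag_iff g hg, ← R.diag_iff g hg, key g hg hgw, key g hg hgw]

end FrameRep

namespace CylOps

variable {n : ℕ} {A : Type u} [BooleanAlgebra A] {O : CylOps n A}

namespace IsSC

variable (hO : O.IsSC) {W : Type u} (P : PointSystem A W) (R : FrameRep (hO.toIsRC.frame P))

/-- The argument of `c_i c_j` in (12) is a monotone function of `x`, nonzero for nonzero `x`; a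
point realizing it on all of `w` is the partner. -/
theorem exists_partner_of_three_le (hn : 3 ≤ n) {i j : Fin n} (hij : i ≠ j) (w : W) :
    ∃ v, R.Partner (Equiv.swap i j) w v := by
  have hc := hO.toIsRC.c_mono
  have hs := hO.toIsRC.s_mono
  obtain ⟨v, hv⟩ := P.exists_realizer w (fun x => O.s i j (O.c j x) ⊓ O.s j i (O.c i x) ⊓
      (Finset.univ.filter (fun k : Fin n => k ≠ i ∧ k ≠ j)).inf
        (fun k => O.s k i (O.s i j (O.s j k (O.c k x)))))
    (fun x y h => inf_le_inf (inf_le_inf (hs _ _ (hc _ h)) (hs _ _ (hc _ h)))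
      (Finset.inf_mono_fun fun k _ => hs _ _ (hs _ _ (hs _ _ (hc _ h)))))
    (fun x hx hb => by
      have := hO.ax12 hn i j x
      rw [hb, hO.ax1, hO.ax1, le_bot_iff] at this
      exact P.ne_bot hx this)
  refine ⟨v, FrameRep.partner_of_swapLike hij ⟨?_, ?_, fun k hki hkj => ?_⟩ (by omega)⟩
  · exact hO.toIsRC.exists_sub_of_forall_val P hij fun x hx =>
      P.val_mono (inf_le_left.trans inf_le_left) (hv x hx)
  · exact hO.toIsRC.exists_sub_of_forall_val P hij.symm fun x hx =>
      P.val_mono (inf_le_left.trans inf_le_right) (hv x hx)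
  · obtain ⟨u₁, h₁, hu₁⟩ := hO.toIsRC.exists_sub_of_forall_val P hki
      (ψ := fun x => O.s i j (O.s j k (O.c k x))) fun x hx =>
      P.val_mono (inf_le_right.trans (Finset.inf_le (b := k) (by simp [hki, hkj]))) (hv x hx)
    obtain ⟨u₂, h₂, hu₂⟩ := hO.toIsRC.exists_sub_of_forall_val P hij hu₁
    obtain ⟨u₃, h₃, hu₃⟩ := hO.toIsRC.exists_sub_of_forall_val P hkj.symm hu₂
    exact ⟨u₁, u₂, u₃, h₁, h₂, h₃, hu₃⟩

theorem exists_partner_of_eq_two (hn : n = 2) {i j : Fin n} (hi : (i : ℕ) = 0)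
    (hj : (j : ℕ) = 1) (w : W) : ∃ v, R.Partner (Equiv.swap i j) w v := by
  -- On the diagonal a point is its own partner; off it, (11) applies, and its factor `-d_01` fixes
  -- the diagonals of the partner.
  by_cases hE : (hO.toIsRC.frame P).E i j w
  · exact ⟨w, .of_E hE⟩
  have hc := hO.toIsRC.c_mono
  have hs := hO.toIsRC.s_mono
  have hij : i ≠ j := by
    rintro rfl
    omega
  obtain ⟨v, hv⟩ := P.exists_realizer w
    (fun x => (O.d i j)ᶜ ⊓ O.s i j (O.c j x) ⊓ O.s j i (O.c i x))
    (fun x y h => inf_le_inf (inf_le_inf_left _ (hs _ _ (hc _ h))) (hs _ _ (hc _ h)))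
    (fun x hx hb => by
      have := hO.ax11 hn i j hi hj x
      rw [hb, hO.ax1, hO.ax1, le_bot_iff] at this
      exact P.ne_bot (P.val_inf.2 ⟨hx, P.val_compl.2 hE⟩) this)
  have hEv : ¬ (hO.toIsRC.frame P).E i j v :=
    P.val_compl.1 (P.val_mono (inf_le_left.trans inf_le_left) (hv ⊤ (P.val_top w)))
  have hcases : ∀ l : Fin n, l = i ∨ l = j := by
    intro l
    have := l.2
    rcases (show (l : ℕ) = 0 ∨ (l : ℕ) = 1 by omega) with h | h
    · exact Or.inl (Fin.ext (h.trans hi.symm))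
    · exact Or.inr (Fin.ext (h.trans hj.symm))
  have hEw' : ¬ (hO.toIsRC.frame P).E j i w := fun h => hE ((hO.toIsRC.frame P).E_symm h)
  have hEv' : ¬ (hO.toIsRC.frame P).E j i v := fun h => hEv ((hO.toIsRC.frame P).E_symm h)
  refine ⟨v, FrameRep.partner_of_swapLike hij ⟨?_, ?_, fun k hki hkj => ?_⟩ fun _ l m => ?_⟩
  · exact hO.toIsRC.exists_sub_of_forall_val P hij fun x hx =>
      P.val_mono (inf_le_left.trans inf_le_right) (hv x hx)
  · exact hO.toIsRC.exists_sub_of_forall_val P hij.symm fun x hx =>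
      P.val_mono inf_le_right (hv x hx)
  · exact ((hcases k).elim hki hkj).elim
  · rcases hcases l with rfl | rfl <;> rcases hcases m with rfl | rfl <;>
      simp only [Equiv.swap_apply_left, Equiv.swap_apply_right, hE, hEv, hEw', hEv',
        (hO.toIsRC.frame P).E_refl]

theorem exists_partner (hn : 2 ≤ n) {i j : Fin n} (hij : i ≠ j) (w : W) :
    ∃ v, R.Partner (Equiv.swap i j) w v := by
  rcases hn.lt_or_eq with hn | hn
  · exact exists_partner_of_three_le hO P R hn hij w
  have hi := i.2
  have hj := j.2
  have hne : (i : ℕ) ≠ j := fun h => hij (Fin.ext h)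
  rcases (show (i : ℕ) = 0 ∧ (j : ℕ) = 1 ∨ (j : ℕ) = 0 ∧ (i : ℕ) = 1 by omega) with h | h
  · exact exists_partner_of_eq_two hO P R hn.symm h.1 h.2 w
  · rw [Equiv.swap_comm]
    exact exists_partner_of_eq_two hO P R hn.symm h.1 h.2 w

end IsSC

theorem InK.isRC : ∀ {K : CylKind}, O.InK K → O.IsRC
  | .RC, h => h
  | .DC, h => h.toIsRC
  | .SC, h => h.toIsRC

theorem InK.exists_frameRep (hn : 2 ≤ n) {K : CylKind} (hO : O.InK K) {W : Type u}
    (P : PointSystem A W) : ∃ R : FrameRep (hO.isRC.frame P), IsUnitOfKind R.V K := by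
  cases K with
  | RC =>
    obtain ⟨R⟩ := hO.isRC.exists_frameRep P hn
    exact ⟨R, trivial⟩
  | DC =>
    obtain ⟨R⟩ := hO.isRC.exists_frameRep P hn
    exact ⟨R, R.diagonalizable fun i j hij w => IsDC.exists_sub hO P hij w⟩
  | SC =>
    obtain ⟨R⟩ := hO.isRC.exists_frameRep P hn
    obtain ⟨R', hR'⟩ := R.exists_permutable hn fun i j hij w =>
      IsSC.exists_partner hO P R hn hij w
    exact ⟨R', R'.diagonalizable fun i j hij w => IsDC.exists_sub hO.toIsDC P hij w,
      fun f hf i j => hR' f hf _⟩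

end CylOps

/-! ### From representations of frames to embeddings of algebras. -/

namespace FrameRep

variable {n : ℕ} {A W : Type u} [BooleanAlgebra A] {O : CylOps n A} {hO : O.IsRC}
  {P : PointSystem A W} (R : FrameRep (hO.frame P))

/-- The representation of an algebra induced by a representation of a frame of its points. -/
def toHom : BoundedLatticeHom A (Set R.V) where
  toFun x := {f | P.val (R.label f) x}
  map_sup' x y := by
    ext f
    simp
  map_inf' x y := by
    ext f
    simp
  map_top' := by
    ext f
    simp
  map_bot' := by
    ext f
    simp

theorem mem_toHom {x : A} {f : R.V} : f ∈ R.toHom x ↔ P.val (R.label f) x := Iff.rfl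

theorem V_nonempty [Nontrivial A] : R.V.Nonempty := by
  obtain ⟨w, -⟩ := P.exists_val ⊤ top_ne_bot
  obtain ⟨f, hf, -⟩ := R.exists_label w
  exact ⟨f, hf⟩

theorem isCylEmbedding_toHom : IsCylEmbedding O (fullOps R.V) R.toHom where
  injective := by
    have hle : ∀ x y, R.toHom x = R.toHom y → x ≤ y := by
      intro x y h
      by_contra hc
      have hne : x ⊓ yᶜ ≠ ⊥ := fun hb => hc (le_compl_iff_disjoint_right.2
        (disjoint_iff.2 hb) |>.trans (compl_compl y).le)
      obtain ⟨w, hw⟩ := P.exists_val _ hne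
      obtain ⟨f, hf, rfl⟩ := R.exists_label w
      obtain ⟨h1, h2⟩ := P.val_inf.1 hw
      have : (⟨f, hf⟩ : R.V) ∈ R.toHom y := h ▸ (h1 : (⟨f, hf⟩ : R.V) ∈ R.toHom x)
      exact P.val_compl.1 h2 this
    exact fun x y h => le_antisymm (hle x y h) (hle y x h.symm)
  map_c i x := by
    ext f
    constructor
    · intro h
      obtain ⟨v, hT, hv⟩ := hO.exists_T_of_val_c P h
      obtain ⟨g, hg, rfl, e⟩ := R.exists_agree f f.2 i v hT
      refine ⟨⟨g, hg⟩, hv, g i, funext fun l => ?_⟩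
      by_cases hl : l = i
      · rw [hl, Function.update_self]
      · rw [Function.update_of_ne hl, ← e l hl]
    · rintro ⟨g, hg, a, e⟩
      refine R.T_of_agree f f.2 g g.2 i (fun l hl => ?_) x hg
      rw [e, Function.update_of_ne hl]
  map_d i j := by
    ext f
    exact (R.diag_iff f f.2 i j).symm

end FrameRep

/-- The corestriction of a homomorphism to a Boolean subalgebra. -/
def BoundedLatticeHom.codRestrict {A : Type u} {B : Type v} [BooleanAlgebra A] [BooleanAlgebra B]
    (f : BoundedLatticeHom A B) (L : BooleanSubalgebra B) (h : ∀ x, f x ∈ L) :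
    BoundedLatticeHom A L where
  toFun x := ⟨f x, h x⟩
  map_sup' x y := Subtype.ext (map_sup f x y)
  map_inf' x y := Subtype.ext (map_inf f x y)
  map_top' := Subtype.ext (map_top f)
  map_bot' := Subtype.ext (map_bot f)

theorem mainTheorem2 (n : ℕ) (hn : 2 ≤ n) (K : CylKind) (A : Type u) [BooleanAlgebra A]
    [Nontrivial A] (O : CylOps n A) (hO : O.InK K) :
    (∃ (B : SetAlgebra.{u} K n) (f : BoundedLatticeHom A B.carrier),
      IsCylEmbedding O B.ops f ∧
      (∀ (S : Set A) (a : A), IsLUB S a → IsLUB (f '' S) (f a)) ∧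
      (∀ (S : Set A) (a : A), IsGLB S a → IsGLB (f '' S) (f a))) ∧
    (IsAtomic A →
      ∃ (B : SetAlgebra.{u} K n) (f : BoundedLatticeHom A B.carrier),
        B.carrier = ⊤ ∧
        IsCylEmbedding O B.ops f ∧
        (∀ (S : Set A) (a : A), IsLUB S a →
          (f a : Set B.unit) = ⋃ x ∈ S, (f x : Set B.unit)) ∧
        (∀ (S : Set A) (a : A), IsGLB S a →
          (f a : Set B.unit) = ⋂ x ∈ S, (f x : Set B.unit))) := by
  constructor
  · obtain ⟨R, hR⟩ := hO.exists_frameRep hn (PointSystem.all A)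
    have hemb := R.isCylEmbedding_toHom
    have hmem : ∀ x, R.toHom x ∈ BooleanSubalgebra.map R.toHom ⊤ := fun x => ⟨x, trivial, rfl⟩
    let f := R.toHom.codRestrict (BooleanSubalgebra.map R.toHom ⊤) hmem
    -- The carrier is the image of the algebra, so `f` is an order isomorphism and keeps all bounds,
    -- even where sums are not unions.
    have hle : ∀ x y, f x ≤ f y → x ≤ y := by
      intro x y h
      have h : R.toHom x ≤ R.toHom y := h
      refine inf_eq_left.1 (hemb.injective ?_)
      rw [map_inf, inf_eq_left.2 h]
    have hmono : Monotone f := OrderHomClass.mono f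
    have hsurj : ∀ b, ∃ x, f x = b := by
      rintro ⟨_, x, -, rfl⟩
      exact ⟨x, rfl⟩
    refine ⟨{ base := R.U
              unit := R.V
              unit_nonempty := R.V_nonempty
              isUnitOfKind := hR
              carrier := BooleanSubalgebra.map R.toHom ⊤
              c_mem := ?_
              d_mem := fun i j => ⟨O.d i j, trivial, hemb.map_d i j⟩ }, f,
      ⟨fun x y h => hemb.injective (congrArg Subtype.val h),
        fun i x => Subtype.ext (hemb.map_c i x), fun i j => Subtype.ext (hemb.map_d i j)⟩, ?_, ?_⟩
    · rintro i _ ⟨x, -, rfl⟩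
      exact ⟨O.c i x, trivial, hemb.map_c i x⟩
    · refine fun S a ha => ⟨hmono.mem_upperBounds_image ha.1, fun b hb => ?_⟩
      obtain ⟨y, rfl⟩ := hsurj b
      exact hmono (ha.2 fun x hx => hle _ _ (hb ⟨x, hx, rfl⟩))
    · refine fun S a ha => ⟨hmono.mem_lowerBounds_image ha.1, fun b hb => ?_⟩
      obtain ⟨y, rfl⟩ := hsurj b
      exact hmono (ha.2 fun x hx => hle _ _ (hb ⟨x, hx, rfl⟩))
  · intro hA
    obtain ⟨R, hR⟩ := hO.exists_frameRep hn (PointSystem.atoms A)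
    have hemb := R.isCylEmbedding_toHom
    refine ⟨{ base := R.U
              unit := R.V
              unit_nonempty := R.V_nonempty
              isUnitOfKind := hR
              carrier := ⊤
              c_mem := fun _ _ _ => trivial
              d_mem := fun _ _ => trivial }, R.toHom.codRestrict ⊤ fun _ => trivial, rfl,
      ⟨fun x y h => hemb.injective (congrArg Subtype.val h),
        fun i x => Subtype.ext (hemb.map_c i x), fun i j => Subtype.ext (hemb.map_d i j)⟩, ?_, ?_⟩
    · intro S a ha
      change R.toHom a = ⋃ x ∈ S, R.toHom x
      ext g
      simp only [Set.mem_iUnion, R.mem_toHom, exists_prop]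
      -- Labels are atoms here, which turns the sum into a union.
      exact (R.label g).2.le_isLUB_iff ha
    · intro S a ha
      change R.toHom a = ⋂ x ∈ S, R.toHom x
      ext g
      simp only [Set.mem_iInter, R.mem_toHom]
      exact le_isGLB_iff ha
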